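/- Let $G=\prod_{k\in\mathbb N}\mathbb Z_2$ be the dyadic group with its normalized Haar measure $\mu$. For $x\in G$ and $n\in\mathbb N=\{0,1,2,\dots\}$ put $I_n(x)=\{y\in G: y_i=x_i \text{ for } 0\le i<n\}$, and let $\mathcal F_n$ be the $\sigma$-algebra generated by the sets $I_n(x)$, $x\in G$. For $0<p<1$ the martingale Hardy space $H_p(G)$ consists of the real-valued martingales $F=(F_n)_{n\in\mathbb N}$ with respect to $(\mathcal F_n)$ for which $$\|F\|_{H_p}:=\Big(\int_G \big(\sup_{n}|F_n|\big)^p\,d\mu\Big)^{1/p}<\infty .$$ For $n\in\mathbb N$ with binary expansion $n=\sum_j n_j2^j$, $n_j\in\{0,1\}$, let $w_n(x)=\prod_{k}(-1)^{n_kx_k}$ be the $n$-th Walsh function, and for $n\ge 1$ let $\rho(n)=|n|-[n]$, where $|n|=\max\{j:n_j\ne0\}$ and $[n]=\min\{j:n_j\neq 0\}$. For a martingale $F$ let $\widehat F(k)=\lim_{n\to\infty}\int_G F_nw_k\,d\mu$ (the limit exists) and $S_nF=\sum_{k=0}^{n-1}\widehat F(k)w_k$. **Theorem 1.** Let $0<p<1$.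 Then the weighted maximal operator $$\widetilde S^{*,\nabla}F:=\sup_{n\ge 1}\frac{|S_nF|}{2^{\rho(n)(1/p-1)}}$$ is bounded from $H_p(G)$ to $\text{weak-}L_p(G)$: there is a constant $c_p$ depending only on $p$ such that for every $F\in H_p(G)$ the function $\widetilde S^{*,\nabla}F$ is measurable and $$\Big(\sup_{\lambda>0}\lambda^p\,\mu\big\{x\in G:\widetilde S^{*,\nabla}F(x)>\lambda\big\}\Big)^{1/p}\le c_p\,\|F\|_{H_p}.$$ -/

import Mathlib

open MeasureTheory Filter Topology Finset
open scoped ENNReal NNReal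

namespace Walsh

/-- The dyadic group: the complete direct product of countably many copies of the group of order
two. Its topology and `σ`-algebra are the product ones. -/
abbrev G : Type := ℕ → ZMod 2

/-- The normalized Haar measure of `G`: the product of the measures giving mass `1/2` to each of
the two elements of the factors. -/
noncomputable def haar : Measure G :=
  Measure.infinitePi fun _ : ℕ => (PMF.uniformOfFintype (ZMod 2)).toMeasure

instance instIsProbabilityMeasureHaar : IsProbabilityMeasure haar := by
  unfold haar; infer_instance

/-- The dyadic interval `I_n(x)`. -/
def interval (n : ℕ) (x : G) : Set G := {y | ∀ i < n, y i = x i}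

theorem interval_eq_union (n : ℕ) (x : G) :
    interval n x = interval (n + 1) x ∪ interval (n + 1) (Function.update x n (x n + 1)) := by
  have key : ∀ a b : ZMod 2, a = b ∨ a = b + 1 := by decide
  ext y
  simp only [interval, Set.mem_ofPred_eq, Set.mem_union]
  constructor
  · intro h
    rcases key (y n) (x n) with h0 | h0
    · left
      intro i hi
      rcases Nat.lt_succ_iff_lt_or_eq.mp hi with hi | rfl
      · exact h i hi
      · exact h0
    · right
      intro i hi
      rcases Nat.lt_succ_iff_lt_or_eq.mp hi with hi | rfl
      · rw [Function.update_of_ne hi.ne]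
        exact h i hi
      · rw [Function.update_self]
        exact h0
  · rintro (h | h) i hi
    · exact h i (by omega)
    · rw [h i (by omega), Function.update_of_ne hi.ne]

theorem measurableSet_interval (n : ℕ) (x : G) : MeasurableSet (interval n x) := by
  have : interval n x = ⋂ i ∈ Set.Iio n, (fun y : G => y i) ⁻¹' {x i} := by
    ext y; simp [interval]
  rw [this]
  exact MeasurableSet.biInter (Set.to_countable _) fun i _ =>
    measurable_pi_apply i (MeasurableSet.singleton (x i))

/-- The dyadic filtration: its `n`-th `σ`-algebra is generated by the intervals `I_n(x)`. -/
def filtration : Filtration ℕ (inferInstance : MeasurableSpace G) where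
  seq n := MeasurableSpace.generateFrom {s | ∃ x, s = interval n x}
  mono' := by
    refine monotone_nat_of_le_succ fun n => MeasurableSpace.generateFrom_le ?_
    rintro _ ⟨x, rfl⟩
    rw [interval_eq_union]
    exact MeasurableSet.union (MeasurableSpace.measurableSet_generateFrom ⟨x, rfl⟩)
      (MeasurableSpace.measurableSet_generateFrom ⟨Function.update x n (x n + 1), rfl⟩)
  le' n := by
    refine MeasurableSpace.generateFrom_le ?_
    rintro _ ⟨x, rfl⟩
    exact measurableSet_interval n x

/-- The binary digit `n_j` of `n`. -/
def digit (n j : ℕ) : ℕ := n / 2 ^ j % 2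

/-- `[n]`: the position of the lowest nonzero binary digit (`0` for `n = 0`). -/
noncomputable def low (n : ℕ) : ℕ := sInf {j | digit n j ≠ 0}

/-- `|n|`: the position of the highest nonzero binary digit (`0` for `n = 0`). -/
noncomputable def high (n : ℕ) : ℕ := sSup {j | digit n j ≠ 0}

/-- `ρ(n) = |n| - [n]`. -/
noncomputable def rho (n : ℕ) : ℕ := high n - low n

/-- The Rademacher function `r_k(x) = (-1)^{x_k}`. -/
def rademacher (k : ℕ) (x : G) : ℝ := (-1) ^ (x k).val

theorem stronglyMeasurable_rademacher (j : ℕ) :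
    StronglyMeasurable[filtration (j + 1)] (rademacher j) := by
  have key : Measurable[filtration (j + 1)] fun x : G => x j := by
    refine @measurable_to_countable' _ _ _ _ (filtration (j + 1)) _ fun c => ?_
    have h : (fun x : G => x j) ⁻¹' {c} = ⋃ v ∈ {v : Fin (j + 1) → ZMod 2 | v (Fin.last j) = c},
        interval (j + 1) (fun i => if h : i < j + 1 then v ⟨i, h⟩ else 0) := by
      ext y
      simp only [Set.mem_preimage, Set.mem_singleton_iff, Set.mem_iUnion, interval,
        Set.mem_ofPred_eq, exists_prop]
      constructor
      · intro hy
        exact ⟨fun i => y i, by simpa using hy, fun i hi => by simp [hi]⟩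
      · rintro ⟨v, hv, h⟩
        rw [h j (by omega), dif_pos (by omega)]
        exact hv
    rw [h]
    exact @MeasurableSet.biUnion _ _ (filtration (j + 1)) _ _ (Set.to_countable _) fun v _ =>
      MeasurableSpace.measurableSet_generateFrom ⟨_, rfl⟩
  exact ((measurable_of_countable fun a : ZMod 2 => (-1 : ℝ) ^ a.val).comp key).stronglyMeasurable

/-- The Walsh function `w_n`, the product of the `r_k ^ n_k` (the factors with `k > |n|` are `1`). -/
noncomputable def walsh (n : ℕ) (x : G) : ℝ :=
  ∏ k ∈ range (high n + 1), rademacher k x ^ digit n k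

theorem stronglyMeasurable_walsh (k : ℕ) :
    StronglyMeasurable[filtration (high k + 1)] (walsh k) := by
  have h : walsh k = fun x => ∏ j ∈ range (high k + 1), rademacher j x ^ digit k j := rfl
  rw [h]
  refine Finset.stronglyMeasurable_fun_prod _ fun j hj => ?_
  have hj' : j + 1 ≤ high k + 1 := by have := Finset.mem_range.mp hj; omega
  exact ((stronglyMeasurable_rademacher j).mono (filtration.mono hj')).pow _

theorem abs_walsh (k : ℕ) (x : G) : |walsh k x| = 1 := by
  simp [walsh, rademacher, Finset.abs_prod, abs_pow]

/-- The `k`-th Walsh-Fourier coefficient `lim_n ∫ F_n w_k` of a martingale. -/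
noncomputable def coeff (F : ℕ → G → ℝ) (k : ℕ) : ℝ :=
  limUnder atTop fun n => ∫ x, F n x * walsh k x ∂haar

/-- The limit defining the coefficients of a martingale exists. -/
theorem tendsto_coeff {F : ℕ → G → ℝ} (hF : Martingale F filtration haar) (k : ℕ) :
    Tendsto (fun n => ∫ x, F n x * walsh k x ∂haar) atTop (𝓝 (coeff F k)) := by
  have hm := stronglyMeasurable_walsh k
  have hint : ∀ n, Integrable (F n * walsh k) haar := fun n =>
    (hF.integrable n).mul_bdd (c := 1)
      (hm.mono (filtration.le _)).aestronglyMeasurable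
      (Eventually.of_forall fun x => by rw [Real.norm_eq_abs, abs_walsh])
  refine tendsto_nhds_limUnder ⟨∫ x, F (high k + 1) x * walsh k x ∂haar, ?_⟩
  refine tendsto_const_nhds.congr' ?_
  filter_upwards [eventually_ge_atTop (high k + 1)] with n hn
  have h1 := condExp_mul_of_stronglyMeasurable_right hm (hint n) (hF.integrable n)
  have h2 := hF.2 _ _ hn
  have h3 : ∫ x, (F n * walsh k) x ∂haar = ∫ x, (F (high k + 1) * walsh k) x ∂haar := by
    rw [← integral_condExp (filtration.le (high k + 1))]
    refine integral_congr_ae ?_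
    filter_upwards [h1, h2] with x hx1 hx2
    rw [hx1, Pi.mul_apply, Pi.mul_apply, hx2]
  exact h3.symm

/-- The partial sum `S_n F` of the Walsh-Fourier series (with `S_0 F = 0`). -/
noncomputable def partialSum (n : ℕ) (F : ℕ → G → ℝ) (x : G) : ℝ :=
  ∑ k ∈ range n, coeff F k * walsh k x

/-- The martingale maximal function `F^* = sup_n |F_n|`. -/
noncomputable def maximal (F : ℕ → G → ℝ) (x : G) : ℝ≥0∞ := ⨆ n, ‖F n x‖ₑ

/-- The quasi-norm of the Hardy space `H_p`. -/
noncomputable def hardyNorm (p : ℝ) (F : ℕ → G → ℝ) : ℝ≥0∞ :=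
  eLpNorm (maximal F) (ENNReal.ofReal p) haar

/-- The dyadic martingale Hardy space `H_p`. -/
def MemHardy (p : ℝ) (F : ℕ → G → ℝ) : Prop :=
  Martingale F filtration haar ∧ hardyNorm p F < ∞

/-- The quasi-norm of weak-`L_p`. -/
noncomputable def weakNorm (p : ℝ) (f : G → ℝ≥0∞) : ℝ≥0∞ :=
  (⨆ (t : ℝ≥0) (_ : 0 < t), (t : ℝ≥0∞) ^ p * haar {x | (t : ℝ≥0∞) < f x}) ^ (1 / p)

/-- The weighted maximal operator `sup_n |S_n F| / 2^{ρ(n)(1/p-1)}`, with values in `[0, ∞]`. The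
index `n = 0` contributes `0`. -/
noncomputable def weightedMaximal (p : ℝ) (F : ℕ → G → ℝ) (x : G) : ℝ≥0∞ :=
  ⨆ n : ℕ, ENNReal.ofReal (|partialSum n F x| / (2 : ℝ) ^ ((rho n : ℝ) * (1 / p - 1)))

end Walsh

/-!
The proof needs neither atoms nor stopping-time decompositions: the weighted maximal operator is
bounded pointwise by `(M g) ^ (1 / p)`, where `g = (F^*) ^ p` is integrable and `M` is the dyadic
maximal function, and the weak-type `(1,1)` inequality for `M` (`mul_haar_lt_dyadicMaximal_le`)
then gives the theorem.

For the pointwise bound (`weightedMaximal_le`) let `m = |n| + 1`, `l = [n]` and `a = 1 / p - 1 > 0`.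
Since `n < 2 ^ m`, the partial sum `S_n F` is the integral of `F_m` against the Dirichlet kernel,
and since `2 ^ l` divides `n`, that kernel is dominated by the sum of `2 ^ j 1_{I_j}` over
`l ≤ j < m` (`enorm_dirichletKernel_le`). Hence `|S_n F(x)|` is at most the sum over these `j` of
the averages of `|F_m|` over `I_j(x)`. As `F_m` is constant on intervals of length `2 ^ (-m)`, its
integral over `I_j(x)` is at most `2 ^ (m a)` times the `L_p` quasi-norm of `F^*` on `I_j(x)`
(`lintegral_enorm_le`), that is, at most `2 ^ (m a) (2 ^ (-j) M g(x)) ^ (1 / p)`. So the `j`-th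
average is at most `2 ^ ((m - j) a) (M g(x)) ^ (1 / p)`. The sum over `j ≥ l` is geometric and is
dominated by its first term, of size `2 ^ ((m - l) a)`, which is `2 ^ a` times the weight
`2 ^ (ρ(n) a)`.
-/

namespace Walsh

/-! ### Binary digits and Walsh functions -/

theorem digit_eq_zero_of_lt {n m j : ℕ} (hn : n < 2 ^ m) (hj : m ≤ j) : digit n j = 0 := by
  have h : n < 2 ^ j := hn.trans_le (Nat.pow_le_pow_right (by norm_num) hj)
  simp [digit, Nat.div_eq_of_lt h]

theorem high_eq_log (n : ℕ) : high n = Nat.log 2 n := by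
  rcases eq_or_ne n 0 with rfl | hn
  · simp [high, digit]
  refine IsGreatest.csSup_eq ⟨?_, fun j hj => ?_⟩
  · have h1 : 2 ^ Nat.log 2 n ≤ n := Nat.pow_log_le_self 2 hn
    have h2 : n < 2 ^ (Nat.log 2 n + 1) := Nat.lt_pow_succ_log_self (by norm_num) n
    have h3 : n / 2 ^ Nat.log 2 n = 1 := by
      rw [Nat.div_eq_iff (by positivity)]
      rw [pow_succ] at h2
      omega
    simp [digit, h3]
  · by_contra hlt
    exact hj (digit_eq_zero_of_lt (Nat.lt_pow_succ_log_self (by norm_num) n) (by omega))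

theorem lt_two_pow_high (n : ℕ) : n < 2 ^ (high n + 1) := by
  rw [high_eq_log]
  exact Nat.lt_pow_succ_log_self (by norm_num) n

theorem high_lt {n m : ℕ} (hm : m ≠ 0) (hn : n < 2 ^ m) : high n < m := by
  rw [high_eq_log]
  exact Nat.log_lt_of_lt_pow' hm hn

theorem two_pow_low_dvd (n : ℕ) : 2 ^ low n ∣ n := by
  suffices h : ∀ l ≤ low n, 2 ^ l ∣ n from h _ le_rfl
  intro l
  induction l with
  | zero => simp
  | succ l ih =>
    intro hl
    obtain ⟨q, hq⟩ := ih (by omega)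
    have h0 : digit n l = 0 := by
      by_contra h
      exact absurd (Nat.sInf_le (s := {j | digit n j ≠ 0}) h) (not_le.mpr hl)
    rw [digit, hq, Nat.mul_div_cancel_left _ (by positivity)] at h0
    rw [hq, pow_succ]
    exact mul_dvd_mul_left _ (Nat.dvd_of_mod_eq_zero h0)

theorem low_le_high {n : ℕ} (hn : n ≠ 0) : low n ≤ high n := by
  have h := Nat.le_of_dvd (Nat.pos_of_ne_zero hn) (two_pow_low_dvd n)
  have h' := h.trans_lt (lt_two_pow_high n)
  have := (Nat.pow_lt_pow_iff_right (by norm_num)).mp h'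
  omega

theorem walsh_eq_prod {n m : ℕ} (hn : n < 2 ^ m) (x : G) :
    walsh n x = ∏ k ∈ range m, rademacher k x ^ digit n k := by
  have key : ∀ a b : ℕ, n < 2 ^ a → a ≤ b →
      ∏ k ∈ range a, rademacher k x ^ digit n k = ∏ k ∈ range b, rademacher k x ^ digit n k := by
    intro a b ha hab
    refine prod_subset (range_mono hab) fun k _ hk => ?_
    rw [digit_eq_zero_of_lt ha (by simpa using hk), pow_zero]
  rcases le_total (high n + 1) m with h | h
  · exact key _ _ (lt_two_pow_high n) h
  · exact (key _ _ hn h).symm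

theorem walsh_two_pow_add {k m : ℕ} (hk : k < 2 ^ m) (x : G) :
    walsh (2 ^ m + k) x = rademacher m x * walsh k x := by
  rw [walsh_eq_prod (m := m + 1) (by rw [pow_succ]; omega), prod_range_succ, walsh_eq_prod hk,
    mul_comm]
  congr 1
  · have : digit (2 ^ m + k) m = 1 := by
      simp [digit, Nat.add_div_left, Nat.div_eq_of_lt hk]
    rw [this, pow_one]
  · refine prod_congr rfl fun j hj => ?_
    have hj := mem_range.mp hj
    congr 1
    obtain ⟨d, rfl⟩ : ∃ d, m = j + (d + 1) := ⟨m - j - 1, by omega⟩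
    rw [digit, digit, pow_add, Nat.mul_add_div (by positivity), pow_succ]
    omega

/-! ### The Dirichlet kernel -/

/-- The translated Dirichlet kernel `D_n(x - t)`, as the sum of the products `w_k(x) w_k(t)`. -/
noncomputable def dirichletKernel (n : ℕ) (x t : G) : ℝ :=
  ∑ k ∈ range n, walsh k x * walsh k t

theorem dirichletKernel_two_pow_add {k m : ℕ} (hk : k ≤ 2 ^ m) (x t : G) :
    dirichletKernel (2 ^ m + k) x t = dirichletKernel (2 ^ m) x t +
      rademacher m x * rademacher m t * dirichletKernel k x t := by
  simp only [dirichletKernel]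
  rw [sum_range_add, mul_sum]
  congr 1
  refine sum_congr rfl fun i hi => ?_
  have hi' : i < 2 ^ m := (mem_range.mp hi).trans_le hk
  rw [walsh_two_pow_add hi', walsh_two_pow_add hi']
  ring

theorem rademacher_mul_rademacher (m : ℕ) (x t : G) :
    rademacher m x * rademacher m t = if t m = x m then 1 else -1 := by
  have key : ∀ a b : ZMod 2, Even (a.val + b.val) ↔ b = a := by decide
  rw [rademacher, rademacher, ← pow_add]
  split_ifs with h
  · exact ((key _ _).mpr h).neg_one_pow
  · exact (Nat.not_even_iff_odd.mp (mt (key _ _).mp h)).neg_one_pow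

theorem dirichletKernel_two_pow (m : ℕ) (x t : G) :
    dirichletKernel (2 ^ m) x t = (interval m x).indicator (fun _ => 2 ^ m) t := by
  induction m with
  | zero => simp [dirichletKernel, walsh, interval, digit]
  | succ m ih =>
    have hmem : t ∈ interval (m + 1) x ↔ t ∈ interval m x ∧ t m = x m :=
      ⟨fun h => ⟨fun i hi => h i (by omega), h m (by omega)⟩, fun h i hi =>
        (Nat.lt_succ_iff_lt_or_eq.mp hi).elim (h.1 i) fun e => e ▸ h.2⟩
    rw [pow_succ, mul_two, dirichletKernel_two_pow_add le_rfl, rademacher_mul_rademacher, ih]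
    by_cases h1 : t ∈ interval m x <;> by_cases h2 : t m = x m <;> simp [hmem, h1, h2] <;> ring

/-- If the binary digits of `n` below position `l` vanish, then `D_n` lives on `I_l` and is
dominated there by the kernels `D_{2^j}`, `j ≥ l`. -/
theorem enorm_dirichletKernel_le (l : ℕ) (x t : G) {m n : ℕ} (hn : n < 2 ^ m) (hl : 2 ^ l ∣ n) :
    ‖dirichletKernel n x t‖ₑ ≤
      ∑ j ∈ Ico l m, (interval j x).indicator (fun _ => (2 : ℝ≥0∞) ^ j) t := by
  induction m generalizing n with
  | zero =>
    obtain rfl : n = 0 := by simpa using hn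
    simp [dirichletKernel]
  | succ m ih =>
    rcases lt_or_ge n (2 ^ m) with h | h
    · exact (ih h hl).trans (sum_le_sum_of_subset (Ico_subset_Ico_right (by omega)))
    have hlm : l ≤ m := by
      have h0 := (Nat.le_of_dvd (h.trans_lt' (by positivity)) hl).trans_lt hn
      have := (Nat.pow_lt_pow_iff_right (by norm_num)).mp h0
      omega
    obtain ⟨k, rfl⟩ := Nat.exists_eq_add_of_le h
    have hk : k < 2 ^ m := by rw [pow_succ] at hn; omega
    have hr : ‖rademacher m x * rademacher m t‖ₑ = 1 := by
      rw [rademacher_mul_rademacher]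
      split_ifs <;> simp
    rw [sum_Ico_succ_top hlm, dirichletKernel_two_pow_add hk.le, add_comm]
    refine (enorm_add_le _ _).trans (add_le_add ?_ ?_)
    · rw [enorm_mul, hr, one_mul]
      exact ih hk ((Nat.dvd_add_right (pow_dvd_pow 2 hlm)).mp hl)
    · rw [dirichletKernel_two_pow]
      by_cases ht : t ∈ interval m x <;> simp [ht, enorm_pow, Real.enorm_eq_ofReal]

/-! ### Martingales on dyadic intervals -/

theorem haar_interval (n : ℕ) (x : G) : haar (interval n x) = (2 ^ n)⁻¹ := by
  have h : interval n x = Set.pi (range n) fun i => {x i} := by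
    ext y; simp [interval]
  rw [h, haar, Measure.infinitePi_pi _ fun i _ => MeasurableSet.singleton _]
  have h1 (i : ℕ) : (PMF.uniformOfFintype (ZMod 2)).toMeasure {x i} = 2⁻¹ := by
    rw [PMF.toMeasure_apply_singleton _ _ (MeasurableSet.singleton _)]
    simp [ZMod.card]
  simp [h1, ENNReal.inv_pow]

theorem interval_eq_of_mem {n m : ℕ} (h : n ≤ m) {x y : G} (hy : y ∈ interval m x) :
    interval n y = interval n x := by
  ext z
  exact forall₂_congr fun i hi => by rw [hy i (by omega)]

theorem interval_subset {n m : ℕ} (h : n ≤ m) (x : G) : interval m x ⊆ interval n x :=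
  fun _ hy i hi => hy i (by omega)

/-- A function measurable for the `m`-th dyadic `σ`-algebra is constant on the intervals of
length `2 ^ (-m)`. -/
theorem eq_of_mem_interval {f : G → ℝ} {m : ℕ} (hf : StronglyMeasurable[filtration m] f) {x y : G}
    (hy : y ∈ interval m x) : f y = f x := by
  have key : ∀ s, MeasurableSet[filtration m] s → (x ∈ s ↔ y ∈ s) := by
    refine MeasurableSpace.generateFrom_induction _ _ ?_ ?_ ?_ ?_
    · rintro _ ⟨z, rfl⟩ -
      exact forall₂_congr fun i hi => by rw [hy i hi]
    · simp
    · exact fun _ _ h => not_congr h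
    · intro s _ h
      simp only [Set.mem_iUnion, h]
  exact (key _ (hf.measurable (MeasurableSet.singleton (f x)))).mp rfl

theorem measurable_martingale {F : ℕ → G → ℝ} (hF : Martingale F filtration haar) (m : ℕ) :
    Measurable (F m) :=
  ((hF.stronglyMeasurable m).mono (filtration.le m)).measurable

theorem measurable_maximal {F : ℕ → G → ℝ} (hF : Martingale F filtration haar) :
    Measurable (maximal F) :=
  Measurable.iSup fun n => (measurable_martingale hF n).enorm

theorem measurable_walsh (k : ℕ) : Measurable (walsh k) :=
  ((stronglyMeasurable_walsh k).mono (filtration.le _)).measurable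

/-- The limit defining a Walsh-Fourier coefficient is attained as soon as `|k| < m`. -/
theorem coeff_eq_integral {F : ℕ → G → ℝ} (hF : Martingale F filtration haar) {k m : ℕ}
    (hk : high k < m) : coeff F k = ∫ x, F m x * walsh k x ∂haar := by
  have hm := stronglyMeasurable_walsh k
  refine tendsto_nhds_unique (tendsto_coeff hF k) (tendsto_const_nhds.congr' ?_)
  filter_upwards [eventually_ge_atTop m] with n hn
  have hint : Integrable (F n * walsh k) haar :=
    (hF.integrable n).mul_bdd (c := 1) (measurable_walsh k).aestronglyMeasurable
      (Eventually.of_forall fun x => by rw [Real.norm_eq_abs, abs_walsh])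
  have h1 := condExp_mul_of_stronglyMeasurable_right (hm.mono (filtration.mono hk)) hint
    (hF.integrable n)
  have h2 := hF.2 _ _ hn
  change ∫ x, (F m * walsh k) x ∂haar = ∫ x, (F n * walsh k) x ∂haar
  rw [← integral_condExp (filtration.le m) (f := F n * walsh k)]
  refine integral_congr_ae ?_
  filter_upwards [h1, h2] with x hx1 hx2
  rw [hx1, Pi.mul_apply, Pi.mul_apply, hx2]

theorem partialSum_eq_integral {F : ℕ → G → ℝ} (hF : Martingale F filtration haar) {n m : ℕ}
    (hm : m ≠ 0) (hn : n < 2 ^ m) (x : G) :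
    partialSum n F x = ∫ t, F m t * dirichletKernel n x t ∂haar := by
  simp only [partialSum, dirichletKernel, mul_sum]
  rw [integral_finsetSum]
  · refine sum_congr rfl fun k hk => ?_
    rw [coeff_eq_integral hF (high_lt hm ((mem_range.mp hk).trans hn)), ← integral_mul_const]
    exact integral_congr_ae (Eventually.of_forall fun t => by ring)
  · intro k _
    refine (hF.integrable m).mul_bdd (c := 1)
      ((measurable_walsh k).const_mul _).aestronglyMeasurable (Eventually.of_forall fun t => ?_)
    rw [Real.norm_eq_abs, abs_mul, abs_walsh, abs_walsh, one_mul]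

theorem enorm_partialSum_le {F : ℕ → G → ℝ} (hF : Martingale F filtration haar) {l m n : ℕ}
    (hm : m ≠ 0) (hn : n < 2 ^ m) (hl : 2 ^ l ∣ n) (x : G) :
    ‖partialSum n F x‖ₑ ≤ ∑ j ∈ Ico l m, 2 ^ j * ∫⁻ t in interval j x, ‖F m t‖ₑ ∂haar := by
  rw [partialSum_eq_integral hF hm hn]
  have hmeas := (measurable_martingale hF m).enorm
  calc ‖∫ t, F m t * dirichletKernel n x t ∂haar‖ₑ
      ≤ ∫⁻ t, ‖F m t * dirichletKernel n x t‖ₑ ∂haar := enorm_integral_le_lintegral_enorm _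
    _ ≤ ∫⁻ t, ∑ j ∈ Ico l m, (interval j x).indicator (fun t => 2 ^ j * ‖F m t‖ₑ) t ∂haar := by
        refine lintegral_mono fun t => ?_
        rw [enorm_mul]
        refine (mul_le_mul_right (enorm_dirichletKernel_le l x t hn hl) _).trans_eq ?_
        rw [mul_sum]
        refine sum_congr rfl fun j _ => ?_
        by_cases ht : t ∈ interval j x <;> simp [ht, mul_comm]
    _ = _ := by
        rw [lintegral_finsetSum _ fun j _ =>
          (hmeas.const_mul _).indicator (measurableSet_interval j x)]
        refine sum_congr rfl fun j _ => ?_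
        rw [lintegral_indicator (measurableSet_interval j x), lintegral_const_mul _ hmeas]

/-- A reverse Hölder inequality with exponents `p < 1`: `F_m` is constant on the intervals of
length `2 ^ (-m)`, so on each of them `|F_m|` is at most `(2 ^ m ∫ (F^*) ^ p) ^ (1 / p)`, and it
remains to integrate `|F_m| = |F_m| ^ p * |F_m| ^ (1 - p)`. -/
theorem lintegral_enorm_le {p : ℝ} (hp0 : 0 < p) (hp1 : p < 1) {F : ℕ → G → ℝ}
    (hF : Martingale F filtration haar) {j m : ℕ} (hj : j ≤ m) (x : G) :
    ∫⁻ t in interval j x, ‖F m t‖ₑ ∂haar ≤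
      ((2 : ℝ≥0∞) ^ m) ^ (1 / p - 1) *
        (∫⁻ t in interval j x, maximal F t ^ p ∂haar) ^ (1 / p) := by
  set B := ∫⁻ t in interval j x, maximal F t ^ p ∂haar
  have hle (t : G) : ‖F m t‖ₑ ^ p ≤ maximal F t ^ p :=
    ENNReal.rpow_le_rpow (le_iSup (fun n => ‖F n t‖ₑ) m) hp0.le
  have hpt : ∀ t ∈ interval j x, ‖F m t‖ₑ ^ p ≤ 2 ^ m * B := by
    intro t ht
    have hsub : interval m t ⊆ interval j x := by
      rw [← interval_eq_of_mem le_rfl ht]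
      exact interval_subset hj t
    have h1 : ‖F m t‖ₑ ^ p * (2 ^ m)⁻¹ ≤ B := by
      calc ‖F m t‖ₑ ^ p * (2 ^ m)⁻¹ = ∫⁻ _ in interval m t, ‖F m t‖ₑ ^ p ∂haar := by
            rw [setLIntegral_const, haar_interval]
        _ ≤ ∫⁻ s in interval m t, maximal F s ^ p ∂haar := by
            refine setLIntegral_mono' (measurableSet_interval m t) fun s hs => ?_
            rw [← eq_of_mem_interval (hF.stronglyMeasurable m) hs]
            exact hle s
        _ ≤ B := lintegral_mono_set hsub
    rw [← div_eq_mul_inv, ENNReal.div_le_iff (by simp) (by simp)] at h1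
    rwa [mul_comm]
  have ha : 0 ≤ 1 / p - 1 := by
    rw [sub_nonneg, le_div_iff₀ hp0]
    linarith
  calc ∫⁻ t in interval j x, ‖F m t‖ₑ ∂haar
      ≤ ∫⁻ t in interval j x, maximal F t ^ p * (2 ^ m * B) ^ (1 / p - 1) ∂haar := by
        refine setLIntegral_mono' (measurableSet_interval j x) fun t ht => ?_
        have h : ‖F m t‖ₑ = ‖F m t‖ₑ ^ p * (‖F m t‖ₑ ^ p) ^ (1 / p - 1) := by
          rw [← ENNReal.rpow_mul, ← ENNReal.rpow_add_of_nonneg _ _ hp0.le (by positivity)]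
          have : p + p * (1 / p - 1) = 1 := by field_simp; ring
          rw [this, ENNReal.rpow_one]
        rw [h]
        exact mul_le_mul' (hle t) (ENNReal.rpow_le_rpow (hpt t ht) ha)
    _ = B * (2 ^ m * B) ^ (1 / p - 1) :=
        lintegral_mul_const _ ((measurable_maximal hF).pow_const p)
    _ = _ := by
        have h : B ^ (1 / p) = B * B ^ (1 / p - 1) := by
          nth_rw 2 [← ENNReal.rpow_one B]
          rw [← ENNReal.rpow_add_of_nonneg _ _ zero_le_one ha]
          congr 1
          ring
        rw [ENNReal.mul_rpow_of_nonneg _ _ ha, h]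
        ring

/-! ### The dyadic maximal function -/

/-- The average of `g` over the interval `I_j(x)`, which has measure `2 ^ (-j)`. -/
noncomputable def average (g : G → ℝ≥0∞) (j : ℕ) (x : G) : ℝ≥0∞ :=
  2 ^ j * ∫⁻ t in interval j x, g t ∂haar

/-- The dyadic maximal function. -/
noncomputable def dyadicMaximal (g : G → ℝ≥0∞) (x : G) : ℝ≥0∞ := ⨆ j, average g j x

/-- The weak-type `(1,1)` inequality: the set where the maximal function exceeds `s` is the
disjoint union of the longest intervals over which the average of `g` exceeds `s`. -/
theorem mul_haar_lt_dyadicMaximal_le (g : G → ℝ≥0∞) (s : ℝ≥0∞) :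
    s * haar {x | s < dyadicMaximal g x} ≤ ∫⁻ t, g t ∂haar := by
  -- `x` satisfies `P j x` when `I_j(x)` is the longest interval around `x` with large average.
  let P : ℕ → G → Prop := fun j x => s < average g j x ∧ ∀ i < j, average g i x ≤ s
  have hP {j : ℕ} {x y : G} (hy : y ∈ interval j x) (hx : P j x) : P j y := by
    have h (i : ℕ) (hi : i ≤ j) : average g i y = average g i x := by
      rw [average, average, interval_eq_of_mem hi hy]
    exact ⟨h j le_rfl ▸ hx.1, fun i hi => h i hi.le ▸ hx.2 i hi⟩
  let e : (w : Σ j, Fin j → ZMod 2) → G := fun w i => if h : i < w.1 then w.2 ⟨i, h⟩ else 0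
  let I : {w : Σ j, Fin j → ZMod 2 // P w.1 (e w)} → Set G := fun w => interval w.1.1 (e w.1)
  have hmeas (w) : MeasurableSet (I w) := measurableSet_interval _ _
  have hdisj : Pairwise (Function.onFun Disjoint I) := by
    intro w w' hne
    refine Set.disjoint_left.mpr fun y hy hy' => hne ?_
    obtain ⟨⟨j, v⟩, hw⟩ := w
    obtain ⟨⟨j', v'⟩, hw'⟩ := w'
    have h := hP hy hw
    have h' := hP hy' hw'
    have hjj : j = j' := by
      rcases lt_trichotomy j j' with hlt | heq | hlt
      · exact absurd h.1 (not_lt.mpr (h'.2 _ hlt))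
      · exact heq
      · exact absurd h'.1 (not_lt.mpr (h.2 _ hlt))
    subst hjj
    have hv : v = v' := by
      funext i
      have h1 := hy i i.2
      have h2 := hy' i i.2
      simp only [e, i.2, dif_pos] at h1 h2
      exact h1.symm.trans h2
    subst hv
    rfl
  have hsub : {x | s < dyadicMaximal g x} ⊆ ⋃ w, I w := by
    classical
    intro x hx
    have hex : ∃ j, s < average g j x := lt_iSup_iff.mp hx
    let v : Fin (Nat.find hex) → ZMod 2 := fun i => x i
    have hxe : e ⟨_, v⟩ ∈ interval (Nat.find hex) x := fun i hi => by simp [e, v, hi]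
    have hPx : P (Nat.find hex) x :=
      ⟨Nat.find_spec hex, fun i hi => not_lt.mp (Nat.find_min hex hi)⟩
    refine Set.mem_iUnion.mpr ⟨⟨⟨_, v⟩, hP hxe hPx⟩, fun i hi => (hxe i hi).symm⟩
  calc s * haar {x | s < dyadicMaximal g x} ≤ s * haar (⋃ w, I w) := by gcongr
    _ = ∑' w, s * haar (I w) := by rw [measure_iUnion hdisj hmeas, ENNReal.tsum_mul_left]
    _ ≤ ∑' w, ∫⁻ t in I w, g t ∂haar := by
        refine ENNReal.tsum_le_tsum fun w => ?_
        have h := w.2.1.le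
        rw [haar_interval, ← div_eq_mul_inv]
        rw [average, mul_comm] at h
        exact ENNReal.div_le_of_le_mul h
    _ = ∫⁻ t in ⋃ w, I w, g t ∂haar := (lintegral_iUnion hmeas hdisj g).symm
    _ ≤ ∫⁻ t, g t ∂haar := setLIntegral_le_lintegral _ _

/-! ### The weighted maximal operator -/

theorem measurable_weightedMaximal (p : ℝ) (F : ℕ → G → ℝ) : Measurable (weightedMaximal p F) := by
  refine Measurable.iSup fun n => ENNReal.measurable_ofReal.comp (Measurable.div_const ?_ _)
  have h : Measurable (partialSum n F) := by
    unfold partialSum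
    exact Finset.measurable_sum _ fun k _ => (measurable_walsh k).const_mul _
  exact h.norm

/-- The constant in the pointwise bound: the sum of the geometric series of ratio
`2 ^ (-(1 / p - 1))`, times a factor `2 ^ (1 / p - 1)` that accounts for `m = |n| + 1`. -/
noncomputable def boundConst (p : ℝ) : ℝ≥0∞ :=
  2 ^ (1 / p - 1) * ∑' i : ℕ, (((2 : ℝ≥0∞) ^ (1 / p - 1))⁻¹) ^ i

theorem boundConst_ne_top {p : ℝ} (hp0 : 0 < p) (hp1 : p < 1) : boundConst p ≠ ∞ := by
  have ha : 0 < 1 / p - 1 := by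
    rw [sub_pos, lt_div_iff₀ hp0]
    linarith
  have h1 : (1 : ℝ≥0∞) < 2 ^ (1 / p - 1) := ENNReal.one_lt_rpow (by norm_num) ha
  refine ENNReal.mul_ne_top (ENNReal.rpow_ne_top_of_nonneg ha.le (by simp)) ?_
  rw [ENNReal.tsum_geometric, ENNReal.inv_ne_top]
  exact (tsub_pos_of_lt (ENNReal.inv_lt_one.mpr h1)).ne'

theorem boundConst_ne_zero (p : ℝ) : boundConst p ≠ 0 := by
  refine mul_ne_zero (ENNReal.rpow_pos (by norm_num) (by simp)).ne' ?_
  rw [ENNReal.tsum_geometric, ENNReal.inv_ne_zero]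
  exact ENNReal.sub_ne_top (by simp)

/-- The weighted maximal operator is controlled pointwise by the dyadic
maximal function of `(F^*) ^ p`. -/
theorem weightedMaximal_le {p : ℝ} (hp0 : 0 < p) (hp1 : p < 1) {F : ℕ → G → ℝ}
    (hF : Martingale F filtration haar) (x : G) :
    weightedMaximal p F x ≤
      boundConst p * dyadicMaximal (fun t => maximal F t ^ p) x ^ (1 / p) := by
  refine iSup_le fun n => ?_
  rcases eq_or_ne n 0 with rfl | hn0
  · simp [partialSum]
  have ha : 0 < 1 / p - 1 := by
    rw [sub_pos, lt_div_iff₀ hp0]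
    linarith
  set a := 1 / p - 1 with ha_def
  have hpa : 1 / p = 1 + a := by rw [ha_def]; ring
  set q : ℝ≥0∞ := 2 ^ a with hq
  have hq0 : q ≠ 0 := (ENNReal.rpow_pos (by norm_num) (by simp)).ne'
  have hqt : q ≠ ∞ := ENNReal.rpow_ne_top_of_nonneg ha.le (by simp)
  have hqpow (k : ℕ) : ((2 : ℝ≥0∞) ^ k) ^ a = q ^ k := by
    rw [hq, ← ENNReal.rpow_natCast, ← ENNReal.rpow_natCast, ← ENNReal.rpow_mul,
      ← ENNReal.rpow_mul, mul_comm]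
  set M := dyadicMaximal (fun t => maximal F t ^ p) x
  obtain ⟨r, hr⟩ := Nat.exists_eq_add_of_le (low_le_high hn0)
  have hrho : rho n = r := by rw [rho]; omega
  set l := low n with hl
  have hterm (i : ℕ) (hi : l + i ≤ l + r + 1) :
      2 ^ (l + i) * ∫⁻ t in interval (l + i) x, ‖F (l + r + 1) t‖ₑ ∂haar ≤
        q ^ r * (q * (q⁻¹) ^ i * M ^ (1 / p)) := by
    have hA : average (fun t => maximal F t ^ p) (l + i) x ≤ M :=
      le_iSup (fun j => average (fun t => maximal F t ^ p) j x) (l + i)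
    have h1 := lintegral_enorm_le hp0 hp1 hF hi x
    rw [← ha_def, hqpow] at h1
    set B := ∫⁻ t in interval (l + i) x, maximal F t ^ p ∂haar
    have h2 : B ≤ (2 ^ (l + i))⁻¹ * M := by
      rw [← ENNReal.div_eq_inv_mul, ENNReal.le_div_iff_mul_le (by simp) (by simp), mul_comm]
      exact hA
    calc 2 ^ (l + i) * ∫⁻ t in interval (l + i) x, ‖F (l + r + 1) t‖ₑ ∂haar
        ≤ 2 ^ (l + i) * (q ^ (l + r + 1) * ((2 ^ (l + i))⁻¹ * M) ^ (1 / p)) := by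
          gcongr
          refine h1.trans ?_
          gcongr
      _ = (2 ^ (l + i) * (2 ^ (l + i))⁻¹) * q ^ (l + r + 1) * (q ^ (l + i))⁻¹ * M ^ (1 / p) := by
          rw [ENNReal.mul_rpow_of_nonneg _ _ (by positivity)]
          conv_lhs => rw [hpa]
          rw [ENNReal.rpow_add_of_nonneg _ _ zero_le_one ha.le, ENNReal.rpow_one,
            ENNReal.inv_rpow, hqpow, ← hpa]
          ring
      _ = (q ^ l * (q ^ l)⁻¹) * (q ^ r * (q * (q⁻¹) ^ i * M ^ (1 / p))) := by
          rw [ENNReal.mul_inv_cancel (by simp) (by simp), pow_add q l i,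
            ENNReal.mul_inv (Or.inl (pow_ne_zero _ hq0)) (Or.inl (ENNReal.pow_ne_top hqt)),
            pow_add, pow_add, ENNReal.inv_pow (a := q) (n := i)]
          ring
      _ = _ := by
          rw [ENNReal.mul_inv_cancel (pow_ne_zero _ hq0) (ENNReal.pow_ne_top hqt), one_mul]
  have hsum : ‖partialSum n F x‖ₑ ≤ q ^ r * (boundConst p * M ^ (1 / p)) := by
    have hlt := lt_two_pow_high n
    rw [hr] at hlt
    refine (enorm_partialSum_le hF (by omega) hlt (two_pow_low_dvd n) x).trans ?_
    rw [← hl, sum_Ico_eq_sum_range]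
    refine (sum_le_sum fun i hi => hterm i ?_).trans ?_
    · have := mem_range.mp hi
      omega
    rw [← mul_sum, ← sum_mul, ← mul_sum, boundConst, ← ha_def, ← hq]
    gcongr
    exact ENNReal.sum_le_tsum _
  have hden : ENNReal.ofReal ((2 : ℝ) ^ ((rho n : ℝ) * a)) = q ^ r := by
    rw [← ENNReal.ofReal_rpow_of_pos (by norm_num), ENNReal.rpow_mul, hrho, ENNReal.rpow_natCast,
      ← hqpow]
    simp
  rw [ENNReal.ofReal_div_of_pos (by positivity), hden, ← Real.enorm_eq_ofReal_abs]
  refine ENNReal.div_le_of_le_mul ?_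
  rwa [mul_comm]

theorem hardyNorm_eq {p : ℝ} (hp0 : 0 < p) (F : ℕ → G → ℝ) :
    hardyNorm p F = (∫⁻ x, maximal F x ^ p ∂haar) ^ (1 / p) := by
  rw [hardyNorm, eLpNorm_eq_lintegral_rpow_enorm_toReal (by simpa using hp0) (by simp),
    ENNReal.toReal_ofReal hp0.le]
  simp

theorem weakNorm_weightedMaximal_le {p : ℝ} (hp0 : 0 < p) (hp1 : p < 1) {F : ℕ → G → ℝ}
    (hF : Martingale F filtration haar) :
    weakNorm p (weightedMaximal p F) ≤ boundConst p * hardyNorm p F := by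
  have hp : 0 < 1 / p := by positivity
  have hC0 : boundConst p ^ p ≠ 0 :=
    (ENNReal.rpow_pos (pos_iff_ne_zero.mpr (boundConst_ne_zero p))
      (boundConst_ne_top hp0 hp1)).ne'
  have hCt : boundConst p ^ p ≠ ∞ :=
    ENNReal.rpow_ne_top_of_nonneg hp0.le (boundConst_ne_top hp0 hp1)
  have hroot (c : ℝ≥0∞) : (c ^ p) ^ (1 / p) = c := by
    rw [← ENNReal.rpow_mul, mul_one_div_cancel hp0.ne', ENNReal.rpow_one]
  have hpow (c : ℝ≥0∞) : (c ^ (1 / p)) ^ p = c := by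
    rw [← ENNReal.rpow_mul, one_div_mul_cancel hp0.ne', ENNReal.rpow_one]
  rw [hardyNorm_eq hp0, ← hroot (boundConst p), ← ENNReal.mul_rpow_of_nonneg _ _ hp.le, weakNorm]
  refine ENNReal.rpow_le_rpow (iSup₂_le fun t _ => ?_) hp.le
  have hsub : {x | (t : ℝ≥0∞) < weightedMaximal p F x} ⊆
      {x | (t : ℝ≥0∞) ^ p / boundConst p ^ p < dyadicMaximal (fun y => maximal F y ^ p) x} := by
    intro x hx
    have h := ENNReal.rpow_lt_rpow (lt_of_lt_of_le hx (weightedMaximal_le hp0 hp1 hF x)) hp0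
    rw [ENNReal.mul_rpow_of_nonneg _ _ hp0.le, hpow, mul_comm] at h
    exact ENNReal.div_lt_of_lt_mul h
  calc (t : ℝ≥0∞) ^ p * haar {x | (t : ℝ≥0∞) < weightedMaximal p F x}
      ≤ boundConst p ^ p * ((t : ℝ≥0∞) ^ p / boundConst p ^ p * haar
          {x | (t : ℝ≥0∞) ^ p / boundConst p ^ p < dyadicMaximal (fun y => maximal F y ^ p) x}) := by
        rw [← mul_assoc, ENNReal.mul_div_cancel hC0 hCt]
        gcongr
    _ ≤ boundConst p ^ p * ∫⁻ x, maximal F x ^ p ∂haar := by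
        gcongr
        exact mul_haar_lt_dyadicMaximal_le _ _

end Walsh

theorem theorem1 (p : ℝ) (hp0 : 0 < p) (hp1 : p < 1) :
    ∃ C : ℝ≥0, ∀ F : ℕ → Walsh.G → ℝ, Walsh.MemHardy p F →
      Measurable (Walsh.weightedMaximal p F) ∧
      Walsh.weakNorm p (Walsh.weightedMaximal p F) ≤ (C : ℝ≥0∞) * Walsh.hardyNorm p F := by
  refine ⟨(Walsh.boundConst p).toNNReal, fun F hF => ⟨Walsh.measurable_weightedMaximal p F, ?_⟩⟩
  rw [ENNReal.coe_toNNReal (Walsh.boundConst_ne_top hp0 hp1)]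
  exact Walsh.weakNorm_weightedMaximal_le hp0 hp1 hF.1
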